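/- Let $(M,\omega)$ be any (finite-dimensional, smooth, boundaryless) symplectic manifold. Let $Ham(M,\omega)$ be the group of time-one maps $\phi_H^1$ of the time-dependent Hamiltonian vector fields $X_{H_t}$, $\omega(\cdot,X_{H_t})=d(H(t,\cdot))$, generated by compactly supported smooth functions $H\colon[0,1]\times M\to\mathbb{R}$, equipped with the Hofer norm $$\|\phi\|=\inf\left\{\int_0^1\Big(\max_M H(t,\cdot)-\min_M H(t,\cdot)\Big)\,dt \;\middle|\; \phi_H^1=\phi\right\}.$$ For a closed subset $N\subset M$ let $\mathcal{L}(N)=\{\phi(N)\mid \phi\in Ham(M,\omega)\}$ be its orbit, and let $$\delta(N_1,N_2)=\inf\{\|\phi\| \mid \phi\in Ham(M,\omega),\ \phi(N_1)=N_2\}\qquad (N_1,N_2\in\mathcal{L}(N))$$ be the Chekanov–Hofer pseudometric. Call $N$ CH-rigid if $\delta$ is nondegenerate on $\mathcal{L}(N)$, i.e. if $\delta(N_1,N_2)=0$ implies $N_1=N_2$ for all $N_1,N_2\in\mathcal{L}(N)$. A submanifold $N\subset M$ is coisotropic if $T_xN^{\omega}\subset T_xN$ for all $x\in N$, where $T_xN^{\omega}$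 is the $\omega$-orthogonal complement of $T_xN$ in $T_xM$. **Proposition.** Let $N\subset M$ be an embedded submanifold (without boundary) which is closed as a subset of $M$. If $N$ is not coisotropic, then $N$ is not CH-rigid. -/

import Mathlib

open Set Manifold
open scoped Manifold ContDiff ENNReal

noncomputable section

/-- The coordinate expression, in the preferred chart around `x₀`, of a field of bilinear forms
`b` on the tangent spaces of a manifold `M` modelled on `E`: the pull-back of `b` by the inverse of
the chart, evaluated at the point `y` of the model space on the vectors `v, w`. -/
def formInChart {E : Type*} [NormedAddCommGroup E] [NormedSpace ℝ E]
    {M : Type*} [TopologicalSpace M] [ChartedSpace E M]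
    (b : ∀ x : M, TangentSpace 𝓘(ℝ, E) x →L[ℝ] TangentSpace 𝓘(ℝ, E) x →L[ℝ] ℝ)
    (x₀ : M) (y v w : E) : ℝ :=
  b ((extChartAt 𝓘(ℝ, E) x₀).symm y)
    (mfderiv 𝓘(ℝ, E) 𝓘(ℝ, E) (extChartAt 𝓘(ℝ, E) x₀).symm y v)
    (mfderiv 𝓘(ℝ, E) 𝓘(ℝ, E) (extChartAt 𝓘(ℝ, E) x₀).symm y w)

/-- A symplectic form on a smooth manifold `M` (without boundary, modelled on `E`): a smooth,
closed, nondegenerate, alternating 2-form. -/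
structure SymplecticForm (E : Type*) [NormedAddCommGroup E] [NormedSpace ℝ E]
    (M : Type*) [TopologicalSpace M] [ChartedSpace E M] [IsManifold 𝓘(ℝ, E) ∞ M] where
  /-- The underlying bilinear form on each tangent space. -/
  form (x : M) : TangentSpace 𝓘(ℝ, E) x →L[ℝ] TangentSpace 𝓘(ℝ, E) x →L[ℝ] ℝ
  alternating (x : M) (v : TangentSpace 𝓘(ℝ, E) x) : form x v v = 0
  nondegenerate (x : M) (v : TangentSpace 𝓘(ℝ, E) x) (hv : ∀ w, form x v w = 0) : v = 0
  /-- The form depends smoothly on the point, as a section of the bundle of bilinear forms. -/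
  contMDiff : ContMDiff 𝓘(ℝ, E) (𝓘(ℝ, E).prod 𝓘(ℝ, E →L[ℝ] E →L[ℝ] ℝ)) ∞
    (fun x : M ↦ Bundle.TotalSpace.mk' (E →L[ℝ] E →L[ℝ] ℝ) x (form x))
  /-- The exterior derivative of the form, computed in charts on constant vector fields,
  vanishes. -/
  closed (x₀ : M) (y : E) (hy : y ∈ (extChartAt 𝓘(ℝ, E) x₀).target) (u v w : E) :
    fderiv ℝ (fun z ↦ formInChart form x₀ z v w) y u
      - fderiv ℝ (fun z ↦ formInChart form x₀ z u w) y v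
      + fderiv ℝ (fun z ↦ formInChart form x₀ z u v) y w = 0

section Hamiltonian

variable {E : Type*} [NormedAddCommGroup E] [NormedSpace ℝ E] [FiniteDimensional ℝ E]
  {M : Type*} [TopologicalSpace M] [ChartedSpace E M] [IsManifold 𝓘(ℝ, E) ∞ M]

/-- By nondegeneracy, every covector `α` at `x` is of the form `Ω(·, X)`. -/
theorem SymplecticForm.exists_dual (Ω : SymplecticForm E M) (x : M)
    (α : TangentSpace 𝓘(ℝ, E) x →L[ℝ] ℝ) :
    ∃ X : TangentSpace 𝓘(ℝ, E) x, ∀ v, Ω.form x v X = α v := by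
  have hanti : ∀ v w : TangentSpace 𝓘(ℝ, E) x, Ω.form x v w = - Ω.form x w v := by
    intro v w
    have h := Ω.alternating x (v + w)
    simp only [map_add, add_apply, Ω.alternating, zero_add, add_zero] at h
    linarith
  have : FiniteDimensional ℝ (TangentSpace 𝓘(ℝ, E) x) := inferInstanceAs (FiniteDimensional ℝ E)
  let B : TangentSpace 𝓘(ℝ, E) x →ₗ[ℝ] Module.Dual ℝ (TangentSpace 𝓘(ℝ, E) x) :=
    { toFun := fun v ↦ (Ω.form x v : TangentSpace 𝓘(ℝ, E) x →ₗ[ℝ] ℝ)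
      map_add' := fun v w ↦ by ext; simp
      map_smul' := fun c v ↦ by ext; simp }
  have hinj : Function.Injective B := by
    rw [← LinearMap.ker_eq_bot, LinearMap.ker_eq_bot']
    intro v hv
    exact Ω.nondegenerate x v (fun w ↦ LinearMap.congr_fun hv w)
  have hsurj : Function.Surjective B :=
    (LinearMap.injective_iff_surjective_of_finrank_eq_finrank
      (Subspace.dual_finrank_eq (K := ℝ) (V := TangentSpace 𝓘(ℝ, E) x)).symm).1 hinj
  obtain ⟨X, hX⟩ := hsurj (-(α : TangentSpace 𝓘(ℝ, E) x →ₗ[ℝ] ℝ))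
  refine ⟨X, fun v ↦ ?_⟩
  have h : Ω.form x X v = -α v := LinearMap.congr_fun hX v
  rw [hanti, h, neg_neg]

/-- The Hamiltonian vector field `X_f` of a function `f : M → ℝ`, determined by
`Ω(·, X_f) = df`. -/
def hamiltonianVectorField (Ω : SymplecticForm E M) (f : M → ℝ) (x : M) :
    TangentSpace 𝓘(ℝ, E) x :=
  Classical.choose (Ω.exists_dual x (mfderiv 𝓘(ℝ, E) 𝓘(ℝ, ℝ) f x))

theorem form_hamiltonianVectorField (Ω : SymplecticForm E M) (f : M → ℝ) (x : M)
    (v : TangentSpace 𝓘(ℝ, E) x) :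
    Ω.form x v (hamiltonianVectorField Ω f x) = mfderiv 𝓘(ℝ, E) 𝓘(ℝ, ℝ) f x v :=
  Classical.choose_spec (Ω.exists_dual x (mfderiv 𝓘(ℝ, E) 𝓘(ℝ, ℝ) f x)) v

/-- `H` restricts to a smooth compactly supported function `[0,1] × M → ℝ` (the values of `H t`
for `t` outside `[0,1]` play no role). -/
structure IsCompactlySupportedHamiltonian (E : Type*) [NormedAddCommGroup E] [NormedSpace ℝ E]
    {M : Type*} [TopologicalSpace M] [ChartedSpace E M] (H : ℝ → M → ℝ) : Prop where
  smooth : ContMDiffOn (𝓘(ℝ, ℝ).prod 𝓘(ℝ, E)) 𝓘(ℝ, ℝ) ∞ (fun p : ℝ × M ↦ H p.1 p.2)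
    (Icc (0 : ℝ) 1 ×ˢ univ)
  support : ∃ K : Set M, IsCompact K ∧ ∀ t ∈ Icc (0 : ℝ) 1, ∀ x, x ∉ K → H t x = 0

/-- `φ` is the time-one map of the time-dependent Hamiltonian vector field `X_{H_t}`,
`0 ≤ t ≤ 1`: for every starting point `x`, there is an integral curve `γ : [0,1] → M` of the
time-dependent vector field with `γ 0 = x` and `γ 1 = φ x`. -/
def IsTimeOneMap (Ω : SymplecticForm E M) (H : ℝ → M → ℝ) (φ : M → M) : Prop :=
  ∀ x : M, ∃ γ : ℝ → M, γ 0 = x ∧ γ 1 = φ x ∧ ∀ t ∈ Icc (0 : ℝ) 1,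
    HasMFDerivWithinAt 𝓘(ℝ, ℝ) 𝓘(ℝ, E) γ (Icc (0 : ℝ) 1) t
      ((1 : ℝ →L[ℝ] ℝ).smulRight (hamiltonianVectorField Ω (H t) (γ t)))

/-- `Ham(M, Ω)`: the time-one maps of compactly supported smooth time-dependent Hamiltonians.
(Such a map is automatically a diffeomorphism of `M`, and these maps form a group under
composition.) -/
def Ham (Ω : SymplecticForm E M) : Set (M → M) :=
  {φ | ∃ H : ℝ → M → ℝ, IsCompactlySupportedHamiltonian E H ∧ IsTimeOneMap Ω H φ}

/-- `∫₀¹ (max_M H(t,·) - min_M H(t,·)) dt`. -/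
def hoferLength {M : Type*} (H : ℝ → M → ℝ) : ℝ≥0∞ :=
  ∫⁻ t in Icc (0 : ℝ) 1, ENNReal.ofReal ((⨆ x, H t x) - (⨅ x, H t x))

/-- The Hofer norm of `φ`: the infimum of the lengths of the compactly supported smooth
Hamiltonians whose time-one map is `φ`. It is finite on `Ham(M, Ω)`. -/
def hoferNorm (Ω : SymplecticForm E M) (φ : M → M) : ℝ≥0∞ :=
  ⨅ (H : ℝ → M → ℝ) (_ : IsCompactlySupportedHamiltonian E H) (_ : IsTimeOneMap Ω H φ),
    hoferLength H

/-- The orbit `ℒ(N) = {φ(N) | φ ∈ Ham(M, Ω)}` of a subset `N` of `M`. -/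
def hamOrbit (Ω : SymplecticForm E M) (N : Set M) : Set (Set M) :=
  {N' | ∃ φ ∈ Ham Ω, N' = φ '' N}

/-- The Chekanov--Hofer pseudometric:
`δ(N₁, N₂) = inf {‖φ‖ | φ ∈ Ham(M, Ω), φ(N₁) = N₂}`. -/
def chekanovHofer (Ω : SymplecticForm E M) (N₁ N₂ : Set M) : ℝ≥0∞ :=
  ⨅ (φ : M → M) (_ : φ ∈ Ham Ω) (_ : φ '' N₁ = N₂), hoferNorm Ω φ

/-- `N` is CH-rigid if the Chekanov--Hofer pseudometric on the orbit of `N` is nondegenerate. -/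
def IsCHRigid (Ω : SymplecticForm E M) (N : Set M) : Prop :=
  ∀ N₁ ∈ hamOrbit Ω N, ∀ N₂ ∈ hamOrbit Ω N, chekanovHofer Ω N₁ N₂ = 0 → N₁ = N₂

/-- The submanifold `N = f(X)` parametrized by the smooth embedding `f : X → M` is coisotropic:
at every point `f p`, the `Ω`-orthogonal complement of the tangent space
`T N = range (df_p)` is contained in `T N`. -/
def IsCoisotropic (F : Type*) [NormedAddCommGroup F] [NormedSpace ℝ F]
    {X : Type*} [TopologicalSpace X] [ChartedSpace F X]
    (Ω : SymplecticForm E M) (f : X → M) : Prop :=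
  ∀ (p : X) (v : TangentSpace 𝓘(ℝ, E) (f p)),
    (∀ u : TangentSpace 𝓘(ℝ, F) p, Ω.form (f p) v (mfderiv 𝓘(ℝ, F) 𝓘(ℝ, E) f p u) = 0) →
    ∃ u : TangentSpace 𝓘(ℝ, F) p, mfderiv 𝓘(ℝ, F) 𝓘(ℝ, E) f p u = v

end Hamiltonian

end

/-! If `N` is not coisotropic at `f p`, some `v` in `TN^ω` is not tangent to `N`. The covector `Ω(·,
v)` kills `TN`, so there is a compactly supported `h`, vanishing on all of `N`, whose Hamiltonian
field at `f p` is `v`. Let `Φ` be its flow.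

For a function `g` of one variable, `X_{g∘h} = g'(h) X_h`, and `h` is constant along orbits. Hence
the time-one map of `g∘h` sends `x` to the point reached from `x` under `Φ` at time `g'(h(x))`
(`SymplecticForm.exists_flow_extendByZero`). On `N` this time is `g'(0)`, whatever the size of `g`:
functions `g` with `g'(0) = s` and `|g| ≤ ε` realise the same image of `N` at Hofer cost at most
`2ε`. So `N` and its time-`s` image are at distance zero (`chekanovHofer_flow_eq_zero`).

Rigidity would then force `Φ` to preserve `N` for all times in `[0,1]`. The orbit of `f p` would
stay in `N`, so its initial velocity `v` would be tangent to `N`, a contradiction. -/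

/-! ### Flows of compactly supported vector fields on a vector space. -/

section FlowInVectorSpace

variable {E : Type*} [NormedAddCommGroup E] [NormedSpace ℝ E]

/-- Compact support makes `V` globally bounded and Lipschitz, so Picard–Lindelöf applies on a
prescribed interval. The open interval `(-2, 2)` leaves room around `[-1, 1]`, where the
reparametrised times will lie. -/
theorem exists_integralCurve_of_hasCompactSupport [FiniteDimensional ℝ E] {V : E → E}
    (hV : ContDiff ℝ 1 V) (hc : HasCompactSupport V) (y : E) :
    ∃ α : ℝ → E, α 0 = y ∧ ∀ t ∈ Ioo (-2 : ℝ) 2, HasDerivAt α (V (α t)) t := by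
  obtain ⟨K, hK⟩ := ContDiff.lipschitzWith_of_hasCompactSupport hc hV one_ne_zero
  obtain ⟨C, hC⟩ := hV.continuous.bounded_above_of_compact_support hc
  have hC0 : 0 ≤ C := (norm_nonneg _).trans (hC 0)
  have h0 : (0 : ℝ) ∈ Icc (-2 : ℝ) 2 := by norm_num
  have hpl : IsPicardLindelof (fun _ : ℝ ↦ V) (⟨0, h0⟩ : Icc (-2 : ℝ) 2) y
      (.mk (C * 2) (by positivity)) 0 (.mk C hC0) K := by
    refine ⟨fun t _ ↦ hK.lipschitzOnWith, fun x _ ↦ continuousOn_const, fun t _ x _ ↦ hC x, ?_⟩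
    simp
  obtain ⟨α, hα0, hα⟩ := hpl.exists_eq_forall_mem_Icc_hasDerivWithinAt₀
  exact ⟨α, hα0, fun t ht ↦ (hα t (Ioo_subset_Icc_self ht)).hasDerivAt (Icc_mem_nhds ht.1 ht.2)⟩

/-- A point outside `U` is a rest point, so a curve visiting it is constant by uniqueness and cannot
have started in `U`. -/
theorem integralCurve_mem_of_tsupport_subset {V : E → E} (hV : ContDiff ℝ 1 V)
    (hc : HasCompactSupport V) {U : Set E} (hU : tsupport V ⊆ U) {α : ℝ → E} (h0 : α 0 ∈ U)
    (hα : ∀ t ∈ Ioo (-2 : ℝ) 2, HasDerivAt α (V (α t)) t) {t : ℝ} (ht : t ∈ Ioo (-2 : ℝ) 2) :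
    α t ∈ U := by
  obtain ⟨K, hK⟩ := ContDiff.lipschitzWith_of_hasCompactSupport hc hV one_ne_zero
  by_contra hn
  have hz : V (α t) = 0 := image_eq_zero_of_notMem_tsupport fun h ↦ hn (hU h)
  have heq : EqOn α (fun _ ↦ α t) (Ioo (-2 : ℝ) 2) :=
    ODE_solution_unique_of_mem_Ioo (v := fun _ ↦ V) (s := fun _ ↦ univ) (K := K)
      (fun _ _ ↦ hK.lipschitzOnWith) ht (fun s hs ↦ ⟨hα s hs, mem_univ _⟩)
      (fun s _ ↦ ⟨by simpa [hz] using hasDerivAt_const s (α t), mem_univ _⟩) rfl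
  have h00 : α 0 = α t := heq (show (0 : ℝ) ∈ Ioo (-2 : ℝ) 2 by norm_num)
  exact hn (h00 ▸ h0)

end FlowInVectorSpace

/-! ### The symplectic form in a chart. -/

section ChartForm

variable {E : Type*} [NormedAddCommGroup E] [NormedSpace ℝ E]
  {M : Type*} [TopologicalSpace M] [ChartedSpace E M] [IsManifold 𝓘(ℝ, E) ∞ M]

theorem SymplecticForm.form_neg_swap (Ω : SymplecticForm E M) (x : M)
    (v w : TangentSpace 𝓘(ℝ, E) x) : Ω.form x v w = - Ω.form x w v := by
  have h := Ω.alternating x (v + w)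
  simp only [map_add, add_apply, Ω.alternating, zero_add, add_zero] at h
  linarith

theorem SymplecticForm.eq_of_forall_form_eq (Ω : SymplecticForm E M) (x : M)
    {v w : TangentSpace 𝓘(ℝ, E) x} (h : ∀ u, Ω.form x u v = Ω.form x u w) : v = w := by
  rw [← sub_eq_zero]
  refine Ω.nondegenerate x _ fun u ↦ ?_
  rw [Ω.form_neg_swap, map_sub, h, sub_self, neg_zero]

omit [IsManifold 𝓘(ℝ, E) ∞ M] in
theorem OpenPartialHomeomorph.mdifferentiable_of_mem_maximalAtlas
    {ψ : OpenPartialHomeomorph M E} (hψ : ψ ∈ IsManifold.maximalAtlas 𝓘(ℝ, E) ∞ M) :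
    ψ.MDifferentiable 𝓘(ℝ, E) 𝓘(ℝ, E) :=
  ⟨(contMDiffOn_of_mem_maximalAtlas hψ).mdifferentiableOn (by simp),
    (contMDiffOn_symm_of_mem_maximalAtlas hψ).mdifferentiableOn (by simp)⟩

/-- The pull-back of a symplectic form under the inverse of a chart. -/
noncomputable def SymplecticForm.inChart (Ω : SymplecticForm E M) (ψ : OpenPartialHomeomorph M E) (y : E) :
    E →L[ℝ] E →L[ℝ] ℝ :=
  ContinuousLinearMap.bilinearComp (E := E) (F := E) (G := ℝ) (E' := E) (F' := E)
    (Ω.form (ψ.symm y)) (mfderiv 𝓘(ℝ, E) 𝓘(ℝ, E) ψ.symm y) (mfderiv 𝓘(ℝ, E) 𝓘(ℝ, E) ψ.symm y)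

theorem SymplecticForm.inChart_apply (Ω : SymplecticForm E M) (ψ : OpenPartialHomeomorph M E)
    (y v w : E) :
    Ω.inChart ψ y v w = Ω.form (ψ.symm y) (mfderiv 𝓘(ℝ, E) 𝓘(ℝ, E) ψ.symm y v)
      (mfderiv 𝓘(ℝ, E) 𝓘(ℝ, E) ψ.symm y w) := rfl

theorem SymplecticForm.contDiffOn_inChart [FiniteDimensional ℝ E]
    (Ω : SymplecticForm E M)
    {ψ : OpenPartialHomeomorph M E} (hψ : ψ ∈ IsManifold.maximalAtlas 𝓘(ℝ, E) ∞ M) :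
    ContDiffOn ℝ 1 (Ω.inChart ψ) ψ.target := by
  refine contDiffOn_clm_apply.2 fun v ↦ contDiffOn_clm_apply.2 fun w ↦ ?_
  have hs := contMDiffOn_symm_of_mem_maximalAtlas hψ
  have hvec : ∀ u : E, ContMDiffOn 𝓘(ℝ, E) (𝓘(ℝ, E).prod 𝓘(ℝ, E)) 1
      (fun y ↦ Bundle.TotalSpace.mk' E (E := fun x : M ↦ TangentSpace 𝓘(ℝ, E) x) (ψ.symm y)
        (mfderiv 𝓘(ℝ, E) 𝓘(ℝ, E) ψ.symm y u)) ψ.target := by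
    intro u
    have h1 := hs.contMDiffOn_tangentMapWithin (m := 1) (by norm_cast) ψ.open_target.uniqueMDiffOn
    have h2 : ContMDiffOn 𝓘(ℝ, E) (𝓘(ℝ, E).prod 𝓘(ℝ, E)) 1
      (fun y : E ↦ (⟨y, u⟩ : TangentBundle 𝓘(ℝ, E) E)) ψ.target :=
      contMDiffOn_vectorSpace_iff_contDiffOn.2 contDiffOn_const
    refine (h1.comp h2 fun y hy ↦ hy).congr fun y hy ↦ ?_
    simp only [Function.comp, tangentMapWithin]
    rw [mfderivWithin_of_isOpen ψ.open_target hy]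
  have hΩ := (Ω.contMDiff.of_le (m := 1) (by norm_cast)).comp_contMDiffOn
    (hs.of_le (m := 1) (by norm_cast))
  have h : ContMDiffOn 𝓘(ℝ, E) (𝓘(ℝ, E).prod 𝓘(ℝ, ℝ)) 1
      (fun y ↦ Bundle.TotalSpace.mk' ℝ (E := Bundle.Trivial M ℝ) (ψ.symm y)
        (Ω.inChart ψ y v w)) ψ.target :=
    ContMDiffOn.clm_bundle_apply₂ (F₁ := E) (F₂ := E) hΩ (hvec v) (hvec w)
  intro y hy
  have h' := h y hy
  rw [Bundle.contMDiffWithinAt_totalSpace] at h'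
  exact h'.2.contDiffWithinAt

theorem SymplecticForm.exists_equiv_inChart [FiniteDimensional ℝ E]
    (Ω : SymplecticForm E M)
    {ψ : OpenPartialHomeomorph M E} (hψ : ψ ∈ IsManifold.maximalAtlas 𝓘(ℝ, E) ∞ M) {y : E}
    (hy : y ∈ ψ.target) : ∃ e : E ≃L[ℝ] (E →L[ℝ] ℝ), (e : E →L[ℝ] E →L[ℝ] ℝ) = Ω.inChart ψ y := by
  have hd := (ψ.mdifferentiable_of_mem_maximalAtlas hψ).symm
  have hinj : Function.Injective (Ω.inChart ψ y) := by
    refine (injective_iff_map_eq_zero _).2 fun v hv ↦ ?_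
    have h0 : mfderiv 𝓘(ℝ, E) 𝓘(ℝ, E) ψ.symm y v = 0 := by
      refine Ω.nondegenerate _ _ fun w ↦ ?_
      obtain ⟨u, rfl⟩ := hd.mfderiv_surjective hy w
      exact congr($hv u)
    exact (injective_iff_map_eq_zero _).1 (hd.mfderiv_injective hy) v h0
  have hdim : Module.finrank ℝ E = Module.finrank ℝ (E →L[ℝ] ℝ) := by
    rw [← LinearMap.toContinuousLinearMap.finrank_eq]
    exact (Subspace.dual_finrank_eq (K := ℝ) (V := E)).symm
  let e := LinearEquiv.ofInjectiveOfFinrankEq (Ω.inChart ψ y).toLinearMap hinj hdim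
  exact ⟨e.toContinuousLinearEquiv, by ext; rfl⟩

end ChartForm

/-! ### Extending functions from a chart to the manifold. -/

section ExtendByZero

variable {E : Type*} [NormedAddCommGroup E] {M : Type*} [TopologicalSpace M]

/-- The extension by zero to the whole manifold of a function given in a chart. -/
noncomputable def extendByZero (ψ : OpenPartialHomeomorph M E) (h : E → ℝ) : M → ℝ :=
  ψ.source.indicator (h ∘ ψ)

variable {ψ : OpenPartialHomeomorph M E} {h : E → ℝ}

theorem extendByZero_symm {y : E} (hy : y ∈ ψ.target) :
    extendByZero ψ h (ψ.symm y) = h y := by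
  simp [extendByZero, hy]

theorem extendByZero_of_notMem_image {x : M} (hx : x ∉ ψ.symm '' tsupport h) :
    extendByZero ψ h x = 0 := by
  by_cases hs : x ∈ ψ.source
  · rw [extendByZero, indicator_of_mem hs]
    exact image_eq_zero_of_notMem_tsupport (f := h) fun ht ↦ hx ⟨ψ x, ht, ψ.left_inv hs⟩
  · exact indicator_of_notMem hs _

theorem isCompact_symm_image_tsupport (hc : HasCompactSupport h) (hU : tsupport h ⊆ ψ.target) :
    IsCompact (ψ.symm '' tsupport h) :=
  hc.isCompact.image_of_continuousOn (ψ.continuousOn_symm.mono hU)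

/-- The Hausdorff property enters here: the support, being compact, is closed in `M`, so the
extension vanishes near every point outside the chart domain, including its boundary points. -/
theorem extendByZero_eventuallyEq_zero [T2Space M] (hc : HasCompactSupport h)
    (hU : tsupport h ⊆ ψ.target) {x : M} (hx : x ∉ ψ.source) :
    extendByZero ψ h =ᶠ[nhds x] fun _ ↦ 0 := by
  have hK := (isCompact_symm_image_tsupport hc hU).isClosed
  have hxK : x ∉ ψ.symm '' tsupport h := by
    rintro ⟨y, hy, rfl⟩
    exact hx (ψ.map_target (hU hy))
  filter_upwards [hK.isOpen_compl.mem_nhds hxK] with z hz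
  exact extendByZero_of_notMem_image hz

variable [NormedSpace ℝ E] [ChartedSpace E M]

theorem contMDiff_extendByZero [T2Space M]
    (hψ : ψ ∈ IsManifold.maximalAtlas 𝓘(ℝ, E) ∞ M) (hh : ContDiff ℝ ∞ h)
    (hc : HasCompactSupport h) (hU : tsupport h ⊆ ψ.target) :
    ContMDiff 𝓘(ℝ, E) 𝓘(ℝ, ℝ) ∞ (extendByZero ψ h) := by
  intro x
  by_cases hx : x ∈ ψ.source
  · have h1 : ContMDiffAt 𝓘(ℝ, E) 𝓘(ℝ, ℝ) ∞ (h ∘ ψ) x :=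
      hh.contMDiff.contMDiffAt.comp x
        ((contMDiffOn_of_mem_maximalAtlas hψ).contMDiffAt (ψ.open_source.mem_nhds hx))
    refine h1.congr_of_eventuallyEq ?_
    filter_upwards [ψ.open_source.mem_nhds hx] with z hz
    exact indicator_of_mem hz _
  · exact contMDiffAt_const.congr_of_eventuallyEq (extendByZero_eventuallyEq_zero hc hU hx)

theorem isCompactlySupportedHamiltonian_comp_extendByZero [T2Space M]
    (hψ : ψ ∈ IsManifold.maximalAtlas 𝓘(ℝ, E) ∞ M) (hh : ContDiff ℝ ∞ h)
    (hc : HasCompactSupport h) (hU : tsupport h ⊆ ψ.target) {g : ℝ → ℝ} (hg : ContDiff ℝ ∞ g)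
    (hg0 : g 0 = 0) :
    IsCompactlySupportedHamiltonian E (fun _ : ℝ ↦ g ∘ extendByZero ψ h) where
  smooth := ((hg.contMDiff.comp (contMDiff_extendByZero hψ hh hc hU)).comp
    contMDiff_snd).contMDiffOn
  support := ⟨_, isCompact_symm_image_tsupport hc hU, fun t _ x hx ↦ by
    simp [extendByZero_of_notMem_image hx, hg0]⟩

end ExtendByZero

/-! ### Hamiltonian fields and flows of functions supported in a chart. -/

section HamiltonianInChart

variable {E : Type*} [NormedAddCommGroup E] [NormedSpace ℝ E] [FiniteDimensional ℝ E]
  {M : Type*} [TopologicalSpace M] [ChartedSpace E M] [IsManifold 𝓘(ℝ, E) ∞ M]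

/-- The Hamiltonian vector field of a function given in a chart, in that chart. -/
noncomputable def SymplecticForm.chartField (Ω : SymplecticForm E M)
    (ψ : OpenPartialHomeomorph M E) (h : E → ℝ) (y : E) : E :=
  -(Ω.inChart ψ y).inverse (fderiv ℝ h y)

variable {ψ : OpenPartialHomeomorph M E} {h : E → ℝ}

/-- On the chart target `inverse` is a genuine inverse, and it solves `Ω(X, ·) = dh`. The minus sign
in `chartField` converts this to the convention `Ω(·, X) = dh`. -/
theorem SymplecticForm.inChart_chartField (Ω : SymplecticForm E M)
    (hψ : ψ ∈ IsManifold.maximalAtlas 𝓘(ℝ, E) ∞ M) {y : E} (hy : y ∈ ψ.target) (w : E) :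
    Ω.inChart ψ y w (Ω.chartField ψ h y) = fderiv ℝ h y w := by
  obtain ⟨e, he⟩ := Ω.exists_equiv_inChart hψ hy
  have h1 : Ω.inChart ψ y (Ω.chartField ψ h y) = -fderiv ℝ h y := by
    rw [SymplecticForm.chartField, ← he, ContinuousLinearMap.inverse_equiv]
    simp
  have h2 : Ω.inChart ψ y w (Ω.chartField ψ h y) = -Ω.inChart ψ y (Ω.chartField ψ h y) w := by
    rw [Ω.inChart_apply, Ω.form_neg_swap, Ω.inChart_apply]
  rw [h2, h1]
  simp

omit [FiniteDimensional ℝ E] in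
theorem SymplecticForm.tsupport_chartField_subset (Ω : SymplecticForm E M) :
    tsupport (Ω.chartField ψ h) ⊆ tsupport h := by
  refine closure_minimal (fun y hy ↦ ?_) (isClosed_tsupport h)
  by_contra hn
  refine hy ?_
  have : fderiv ℝ h y = 0 :=
    image_eq_zero_of_notMem_tsupport fun h' ↦ hn (tsupport_fderiv_subset ℝ h')
  simp [SymplecticForm.chartField, this]

/-- Off its support the field is locally zero. On it the chart form is invertible, and operator
inversion is smooth there. -/
theorem SymplecticForm.contDiff_chartField (Ω : SymplecticForm E M)
    (hψ : ψ ∈ IsManifold.maximalAtlas 𝓘(ℝ, E) ∞ M) (hh : ContDiff ℝ ∞ h)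
    (hU : tsupport h ⊆ ψ.target) :
    ContDiff ℝ 1 (Ω.chartField ψ h) := by
  refine contDiff_iff_contDiffAt.2 fun y ↦ ?_
  by_cases hy : y ∈ tsupport (Ω.chartField ψ h)
  swap
  · exact contDiffAt_const.congr_of_eventuallyEq (notMem_tsupport_iff_eventuallyEq.1 hy)
  have hyt := hU (Ω.tsupport_chartField_subset hy)
  obtain ⟨e, he⟩ := Ω.exists_equiv_inChart hψ hyt
  have h1 : ContDiffAt ℝ 1 (Ω.inChart ψ) y :=
    (Ω.contDiffOn_inChart hψ).contDiffAt (ψ.open_target.mem_nhds hyt)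
  have h2 : ContDiffAt ℝ 1 (fun z ↦ (Ω.inChart ψ z).inverse) y := by
    have := contDiffAt_map_inverse (n := 1) e
    rw [he] at this
    exact this.comp y h1
  exact (h2.clm_apply (hh.fderiv_right (m := 1) (by norm_cast)).contDiffAt).neg

theorem hamiltonianVectorField_comp_extendByZero [T2Space M] (Ω : SymplecticForm E M)
    (hψ : ψ ∈ IsManifold.maximalAtlas 𝓘(ℝ, E) ∞ M) (hh : ContDiff ℝ ∞ h)
    (hc : HasCompactSupport h) (hU : tsupport h ⊆ ψ.target) {g : ℝ → ℝ} (hg : ContDiff ℝ ∞ g)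
    {y : E} (hy : y ∈ ψ.target) :
    hamiltonianVectorField Ω (g ∘ extendByZero ψ h) (ψ.symm y) =
      mfderiv 𝓘(ℝ, E) 𝓘(ℝ, E) ψ.symm y (deriv g (h y) • Ω.chartField ψ h y) := by
  have hd := (ψ.mdifferentiable_of_mem_maximalAtlas hψ).symm
  have hsm : MDifferentiableAt 𝓘(ℝ, E) 𝓘(ℝ, ℝ) (g ∘ extendByZero ψ h) (ψ.symm y) :=
    (hg.contMDiff.comp (contMDiff_extendByZero hψ hh hc hU)).mdifferentiable (by simp) _
  refine Ω.eq_of_forall_form_eq _ fun u ↦ ?_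
  obtain ⟨w, rfl⟩ := hd.mfderiv_surjective hy u
  rw [form_hamiltonianVectorField]
  have h1 : mfderiv 𝓘(ℝ, E) 𝓘(ℝ, ℝ) ((g ∘ extendByZero ψ h) ∘ ψ.symm) y w =
      mfderiv 𝓘(ℝ, E) 𝓘(ℝ, ℝ) (g ∘ extendByZero ψ h) (ψ.symm y)
        (mfderiv 𝓘(ℝ, E) 𝓘(ℝ, E) ψ.symm y w) :=
    mfderiv_comp_apply y hsm (hd.mdifferentiableAt hy) w
  have h2 : (g ∘ extendByZero ψ h) ∘ ψ.symm =ᶠ[nhds y] g ∘ h := by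
    filter_upwards [ψ.open_target.mem_nhds hy] with z hz
    simp [extendByZero_symm hz]
  have h3 : HasFDerivAt (g ∘ h) (deriv g (h y) • fderiv ℝ h y) y :=
    ((hg.differentiable (by simp)) _).hasDerivAt.comp_hasFDerivAt y
      ((hh.differentiable (by simp)) y).hasFDerivAt
  refine h1.symm.trans ?_
  rw [h2.mfderiv_eq, mfderiv_eq_fderiv, h3.fderiv]
  have h4 := Ω.inChart_chartField (h := h) hψ hy w
  have h5 : Ω.inChart ψ y w (deriv g (h y) • Ω.chartField ψ h y) =
      (deriv g (h y) • fderiv ℝ h y) w := by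
    rw [map_smul, h4]
    rfl
  exact h5.symm

theorem hamiltonianVectorField_comp_extendByZero_of_notMem [T2Space M] (Ω : SymplecticForm E M)
    (hc : HasCompactSupport h) (hU : tsupport h ⊆ ψ.target) (g : ℝ → ℝ) {x : M}
    (hx : x ∉ ψ.source) :
    hamiltonianVectorField Ω (g ∘ extendByZero ψ h) x = 0 := by
  refine Ω.eq_of_forall_form_eq _ fun u ↦ ?_
  have h2 : g ∘ extendByZero ψ h =ᶠ[nhds x] fun _ ↦ g 0 := by
    filter_upwards [extendByZero_eventuallyEq_zero hc hU hx] with z hz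
    simp [hz]
  rw [form_hamiltonianVectorField, h2.mfderiv_eq, mfderiv_const]
  exact (map_zero (Ω.form x u)).symm

/-- Conservation of energy: `dh(X_h) = Ω(X_h, X_h) = 0`. -/
theorem SymplecticForm.chartField_conserves (Ω : SymplecticForm E M)
    (hψ : ψ ∈ IsManifold.maximalAtlas 𝓘(ℝ, E) ∞ M) (hh : ContDiff ℝ ∞ h) {α : ℝ → E}
    (hα : ∀ t ∈ Ioo (-2 : ℝ) 2, HasDerivAt α (Ω.chartField ψ h (α t)) t ∧ α t ∈ ψ.target)
    {t : ℝ} (ht : t ∈ Ioo (-2 : ℝ) 2) : h (α t) = h (α 0) := by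
  have hd : ∀ s ∈ Ioo (-2 : ℝ) 2, HasDerivAt (h ∘ α) 0 s := by
    intro s hs
    have h1 := ((hh.differentiable (by simp)) (α s)).hasFDerivAt.comp_hasDerivAt s (hα s hs).1
    rwa [← Ω.inChart_chartField hψ (hα s hs).2, Ω.inChart_apply, Ω.alternating] at h1
  exact isOpen_Ioo.is_const_of_deriv_eq_zero isPreconnected_Ioo
    (fun s hs ↦ (hd s hs).differentiableAt.differentiableWithinAt) (fun s hs ↦ (hd s hs).deriv)
    ht (by norm_num)

/-- One flow `Φ` serves every `g`: since `h` is conserved, `c = g'(h)` is constant along each orbit,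
and the orbits of `g∘h` are `t ↦ α (c * t)`. The bound on `g'` keeps `c * t` within `[-1, 1]`. -/
theorem SymplecticForm.exists_flow_extendByZero [T2Space M] (Ω : SymplecticForm E M)
    (hψ : ψ ∈ IsManifold.maximalAtlas 𝓘(ℝ, E) ∞ M) (hh : ContDiff ℝ ∞ h)
    (hc : HasCompactSupport h) (hU : tsupport h ⊆ ψ.target) :
    ∃ Φ : M → ℝ → M,
      (∀ g : ℝ → ℝ, ContDiff ℝ ∞ g → (∀ u, |deriv g u| ≤ 1) →
        IsTimeOneMap Ω (fun _ ↦ g ∘ extendByZero ψ h)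
          (fun x ↦ Φ x (deriv g (extendByZero ψ h x)))) ∧
      ∀ y ∈ ψ.target, ∃ α : ℝ → E, α 0 = y ∧ HasDerivAt α (Ω.chartField ψ h y) 0 ∧
        ∀ t ∈ Ioo (-2 : ℝ) 2, α t ∈ ψ.target ∧ Φ (ψ.symm y) t = ψ.symm (α t) := by
  have hV := Ω.contDiff_chartField hψ hh hU
  have hcV : HasCompactSupport (Ω.chartField ψ h) :=
    hc.of_isClosed_subset (isClosed_tsupport _) Ω.tsupport_chartField_subset
  have hflow : ∀ y : E, ∃ α : ℝ → E, α 0 = y ∧ (y ∈ ψ.target → ∀ t ∈ Ioo (-2 : ℝ) 2,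
      HasDerivAt α (Ω.chartField ψ h (α t)) t ∧ α t ∈ ψ.target) := by
    intro y
    obtain ⟨α, h0, hα⟩ := exists_integralCurve_of_hasCompactSupport hV hcV y
    exact ⟨α, h0, fun hy t ht ↦ ⟨hα t ht, integralCurve_mem_of_tsupport_subset hV hcV
      (Ω.tsupport_chartField_subset.trans hU) (h0 ▸ hy) hα ht⟩⟩
  choose α hα0 hα using hflow
  classical
  -- Points outside the chart domain stay fixed, because the Hamiltonian field vanishes there.
  refine ⟨fun x t ↦ if x ∈ ψ.source then ψ.symm (α (ψ x) t) else x, fun g hg hg1 x ↦ ?_,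
    fun y hy ↦ ⟨α y, hα0 y, ?_, fun t ht ↦ ⟨(hα y hy t ht).2, ?_⟩⟩⟩
  · by_cases hx : x ∈ ψ.source
    · have hy := ψ.map_source hx
      set y := ψ x with hydef
      have hxy : extendByZero ψ h x = h y := indicator_of_mem hx _
      set c := deriv g (h y) with hcdef
      refine ⟨fun t ↦ ψ.symm (α y (c * t)), ?_, ?_, fun t ht ↦ ?_⟩
      · simp [hα0, hydef, hx]
      · simp [hx, hxy, ← hydef, ← hcdef]
      · have hct : c * t ∈ Ioo (-2 : ℝ) 2 := by
          have : |c * t| ≤ 1 := by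
            rw [abs_mul]
            exact mul_le_one₀ (hg1 _) (abs_nonneg _) (abs_le.2 ⟨by linarith [ht.1], ht.2⟩)
          constructor <;> linarith [abs_le.1 this]
        obtain ⟨hd, hmem⟩ := hα y hy _ hct
        have hcons := Ω.chartField_conserves hψ hh (hα y hy) hct
        rw [hα0] at hcons
        rw [hamiltonianVectorField_comp_extendByZero Ω hψ hh hc hU hg hmem, hcons, ← hcdef]
        have h1 : HasDerivAt (fun s ↦ α y (c * s)) (c • Ω.chartField ψ h (α y (c * t))) t :=
          hd.scomp t (by simpa using (hasDerivAt_id t).const_mul c)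
        have h2 := ((ψ.mdifferentiable_of_mem_maximalAtlas hψ).symm.mdifferentiableAt
          hmem).hasMFDerivAt
        refine ((h2.comp t h1.hasFDerivAt.hasMFDerivAt).hasMFDerivWithinAt).congr_mfderiv ?_
        exact ContinuousLinearMap.ext_ring (map_smul (mfderiv 𝓘(ℝ, E) 𝓘(ℝ, E) ψ.symm _) (1 : ℝ) _)
    · refine ⟨fun _ ↦ x, rfl, by simp [hx], fun t _ ↦ ?_⟩
      rw [hamiltonianVectorField_comp_extendByZero_of_notMem Ω hc hU g hx]
      exact (hasMFDerivWithinAt_const x _ t).congr_mfderiv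
        (ContinuousLinearMap.ext_ring (smul_zero (1 : ℝ)).symm)
  · simpa [hα0] using (hα y hy 0 (by norm_num)).1
  · simp [hy]

end HamiltonianInChart

/-! ### Normal form of an immersion. -/

section Straightening

variable {E : Type*} [NormedAddCommGroup E] [NormedSpace ℝ E]
  {M : Type*} [TopologicalSpace M] [ChartedSpace E M]
  {F : Type*} [NormedAddCommGroup F] [NormedSpace ℝ F]
  {X : Type*} [TopologicalSpace X] [ChartedSpace F X] {f : X → M} {p : X}

theorem Manifold.IsImmersionAt.codChart_apply (hi : IsImmersionAt 𝓘(ℝ, F) 𝓘(ℝ, E) ∞ f p) {q : X}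
    (hq : q ∈ hi.domChart.source) : hi.codChart (f q) = hi.equiv (hi.domChart q, 0) := by
  have hqt : hi.domChart q ∈ (hi.domChart.extend 𝓘(ℝ, F)).target := by
    simpa using hi.domChart.map_source hq
  have h := hi.writtenInCharts hqt
  simpa [hi.domChart.left_inv hq] using h

/-- Slice directions of the straightening chart are tangent to `N`: differentiate the local identity
`f ∘ domChart.symm = codChart.symm ∘ L`, where `L` is the linear inclusion of the slice. -/
theorem Manifold.IsImmersionAt.mfderiv_codChart_symm_equiv
    (hi : IsImmersionAt 𝓘(ℝ, F) 𝓘(ℝ, E) ∞ f p) (w : F) :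
    ∃ u : TangentSpace 𝓘(ℝ, F) p, mfderiv 𝓘(ℝ, F) 𝓘(ℝ, E) f p u =
      mfderiv 𝓘(ℝ, E) 𝓘(ℝ, E) hi.codChart.symm (hi.codChart (f p)) (hi.equiv (w, 0)) := by
  have hp := hi.mem_domChart_source
  have hz := hi.domChart.map_source hp
  have hφ := (hi.domChart.mdifferentiable_of_mem_maximalAtlas hi.domChart_mem_maximalAtlas).symm
  have hψ := (hi.codChart.mdifferentiable_of_mem_maximalAtlas hi.codChart_mem_maximalAtlas).symm
  set z := hi.domChart p
  have hzp : hi.domChart.symm z = p := hi.domChart.left_inv hp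
  let L : F →L[ℝ] E := hi.equiv.toContinuousLinearMap ∘L ContinuousLinearMap.inl ℝ F hi.complement
  have hLz : L z = hi.codChart (f p) := (hi.codChart_apply hp).symm
  have heq : f ∘ hi.domChart.symm =ᶠ[nhds z] hi.codChart.symm ∘ L := by
    filter_upwards [hi.domChart.open_target.mem_nhds hz] with y hy
    have hy' := hi.domChart.map_target hy
    have h1 := hi.codChart_apply hy'
    rw [hi.domChart.right_inv hy] at h1
    exact (hi.codChart.left_inv (hi.source_subset_preimage_source hy')).symm.trans
      (congrArg hi.codChart.symm h1)
  have hf : MDifferentiableAt 𝓘(ℝ, F) 𝓘(ℝ, E) f (hi.domChart.symm z) := by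
    rw [hzp]
    exact hi.contMDiffAt.mdifferentiableAt (by simp)
  have h1 := mfderiv_comp_apply z hf (hφ.mdifferentiableAt hz) w
  have h2 : MDifferentiableAt 𝓘(ℝ, E) 𝓘(ℝ, E) hi.codChart.symm (L z) := by
    rw [hLz]
    exact hψ.mdifferentiableAt (hi.codChart.map_source hi.mem_codChart_source)
  have h3 := mfderiv_comp_apply z h2 L.mdifferentiableAt w
  rw [← heq.mfderiv_eq, L.mfderiv_eq, hLz] at h3
  rw [hzp] at h1
  exact ⟨_, h1.symm.trans h3⟩

end Straightening

/-! ### Zero Chekanov–Hofer distance along the flow. -/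

section Hofer

variable {E : Type*} [NormedAddCommGroup E] [NormedSpace ℝ E] [FiniteDimensional ℝ E]
  {M : Type*} [TopologicalSpace M] [ChartedSpace E M] [IsManifold 𝓘(ℝ, E) ∞ M]

theorem id_mem_Ham (Ω : SymplecticForm E M) : id ∈ Ham Ω := by
  refine ⟨fun _ _ ↦ 0, ⟨contMDiffOn_const, ∅, isCompact_empty, fun _ _ _ _ ↦ rfl⟩,
    fun x ↦ ⟨fun _ ↦ x, rfl, rfl, fun t _ ↦ ?_⟩⟩
  have h0 : hamiltonianVectorField Ω (fun _ : M ↦ (0 : ℝ)) x = 0 := by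
    refine Ω.eq_of_forall_form_eq _ fun u ↦ ?_
    rw [form_hamiltonianVectorField, mfderiv_const]
    exact (map_zero (Ω.form x u)).symm
  rw [h0]
  exact (hasMFDerivWithinAt_const x _ t).congr_mfderiv
    (ContinuousLinearMap.ext_ring (smul_zero (1 : ℝ)).symm)

theorem hoferLength_le_of_abs_le {M : Type*} [Nonempty M] {H : ℝ → M → ℝ} {c : ℝ}
    (hH : ∀ t x, |H t x| ≤ c) : hoferLength H ≤ ENNReal.ofReal (2 * c) := by
  have hle : ∀ t, ENNReal.ofReal ((⨆ x, H t x) - ⨅ x, H t x) ≤ ENNReal.ofReal (2 * c) := by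
    intro t
    refine ENNReal.ofReal_le_ofReal ?_
    have h1 : ⨆ x, H t x ≤ c := ciSup_le fun x ↦ (abs_le.1 (hH t x)).2
    have h2 : -c ≤ ⨅ x, H t x := le_ciInf fun x ↦ (abs_le.1 (hH t x)).1
    linarith
  calc hoferLength H ≤ ∫⁻ _ in Icc (0 : ℝ) 1, ENNReal.ofReal (2 * c) :=
        MeasureTheory.lintegral_mono fun t ↦ hle t
    _ = ENNReal.ofReal (2 * c) := by simp

theorem chekanovHofer_le_hoferLength (Ω : SymplecticForm E M) {H : ℝ → M → ℝ} {φ : M → M}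
    (hH : IsCompactlySupportedHamiltonian E H) (hφ : IsTimeOneMap Ω H φ) (N : Set M) :
    chekanovHofer Ω N (φ '' N) ≤ hoferLength H :=
  (iInf₂_le_of_le φ ⟨H, hH, hφ⟩ (iInf_le _ rfl)).trans
    (iInf₂_le_of_le H hH (iInf_le _ hφ))

theorem hasDerivAt_mul_sin_div (s u : ℝ) {ε : ℝ} (hε : ε ≠ 0) :
    HasDerivAt (fun u ↦ s * ε * Real.sin (u / ε)) (s * Real.cos (u / ε)) u := by
  refine (((hasDerivAt_id u).div_const ε).sin.const_mul (s * ε)).congr_deriv ?_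
  simp only [id]
  field_simp

/-- If `h` vanishes on a set `N`, then the time-`s` map of its Hamiltonian flow, `0 ≤ s ≤ 1`, maps
`N` to a set at vanishing Chekanov--Hofer distance from `N`: on `N`, the flow agrees with that of
the arbitrarily small function `s * ε * sin (h / ε)`. -/
theorem chekanovHofer_flow_eq_zero [T2Space M] [Nonempty M] (Ω : SymplecticForm E M)
    {ψ : OpenPartialHomeomorph M E} {h : E → ℝ}
    (hψ : ψ ∈ IsManifold.maximalAtlas 𝓘(ℝ, E) ∞ M) (hh : ContDiff ℝ ∞ h)
    (hc : HasCompactSupport h) (hU : tsupport h ⊆ ψ.target) {Φ : M → ℝ → M}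
    (hΦ : ∀ g : ℝ → ℝ, ContDiff ℝ ∞ g → (∀ u, |deriv g u| ≤ 1) →
      IsTimeOneMap Ω (fun _ ↦ g ∘ extendByZero ψ h)
        (fun x ↦ Φ x (deriv g (extendByZero ψ h x))))
    {N : Set M} (hN : ∀ x ∈ N, extendByZero ψ h x = 0) {s : ℝ} (hs : s ∈ Icc (0 : ℝ) 1) :
    (fun x ↦ Φ x s) '' N ∈ hamOrbit Ω N ∧ chekanovHofer Ω N ((fun x ↦ Φ x s) '' N) = 0 := by
  have key : ∀ ε : ℝ, 0 < ε → ∃ (H : ℝ → M → ℝ) (φ : M → M),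
      IsCompactlySupportedHamiltonian E H ∧ IsTimeOneMap Ω H φ ∧
        φ '' N = (fun x ↦ Φ x s) '' N ∧ ∀ t x, |H t x| ≤ ε := by
    intro ε hε
    -- The slope at `0` is `s` for every `ε`, while the amplitude is only `s * ε`.
    have hderiv : ∀ u, deriv (fun u ↦ s * ε * Real.sin (u / ε)) u = s * Real.cos (u / ε) :=
      fun u ↦ (hasDerivAt_mul_sin_div s u hε.ne').deriv
    have hg : ContDiff ℝ ∞ (fun u ↦ s * ε * Real.sin (u / ε)) := by fun_prop
    have hs1 : |s| ≤ 1 := abs_le.2 ⟨by linarith [hs.1], hs.2⟩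
    refine ⟨_, _, isCompactlySupportedHamiltonian_comp_extendByZero hψ hh hc hU hg (by simp),
      hΦ _ hg fun u ↦ ?_, image_congr fun x hx ↦ ?_, fun t x ↦ ?_⟩
    · rw [hderiv, abs_mul]
      exact mul_le_one₀ hs1 (abs_nonneg _) (Real.abs_cos_le_one _)
    · simp [hderiv, hN x hx]
    · rw [Function.comp, abs_mul, abs_mul, abs_of_pos hε]
      calc |s| * ε * |Real.sin (extendByZero ψ h x / ε)| ≤ 1 * ε * 1 := by
            gcongr
            exact Real.abs_sin_le_one _
        _ = ε := by ring
  constructor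
  · obtain ⟨H, φ, hH, hφ, hN', -⟩ := key 1 one_pos
    exact ⟨φ, ⟨H, hH, hφ⟩, hN'.symm⟩
  · refine le_antisymm (ENNReal.le_of_forall_pos_le_add fun ε hε _ ↦ ?_) zero_le
    -- Half of `ε`, since the oscillation is bounded by twice the supremum norm.
    obtain ⟨H, φ, hH, hφ, hN', hle⟩ := key (ε / 2) (by positivity)
    rw [zero_add, ← hN']
    refine ((chekanovHofer_le_hoferLength Ω hH hφ N).trans
      (hoferLength_le_of_abs_le hle)).trans (le_of_eq ?_)
    rw [mul_div_cancel₀ _ two_ne_zero, ENNReal.ofReal_coe_nnreal]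

end Hofer

/-! ### The cut-off Hamiltonian and the proposition. -/

/-- Multiplying `β` by a bump function keeps its zeros, and leaves it unchanged near `y₀`. -/
theorem exists_contDiff_hasCompactSupport_fderiv_eq {E : Type*} [NormedAddCommGroup E]
    [NormedSpace ℝ E] [FiniteDimensional ℝ E] {y₀ : E} {U : Set E} (hU : U ∈ nhds y₀)
    (β : E →L[ℝ] ℝ) :
    ∃ h : E → ℝ, ContDiff ℝ ∞ h ∧ HasCompactSupport h ∧ tsupport h ⊆ U ∧
      (∀ y, β y = 0 → h y = 0) ∧ fderiv ℝ h y₀ = β := by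
  obtain ⟨r, hr, hrU⟩ := Metric.nhds_basis_closedBall.mem_iff.1 hU
  let χ : ContDiffBump y₀ := ⟨r / 2, r, by positivity, by linarith⟩
  have hsub : tsupport (fun y ↦ χ y * β y) ⊆ tsupport χ := tsupport_mul_subset_left
  refine ⟨fun y ↦ χ y * β y, χ.contDiff.mul β.contDiff, χ.hasCompactSupport.mul_right,
    hsub.trans (χ.tsupport_eq.trans_subset hrU), fun y hy ↦ by simp [hy], ?_⟩
  have h1 : (fun y ↦ χ y * β y) =ᶠ[nhds y₀] β := by
    filter_upwards [χ.eventuallyEq_one] with y hy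
    simp [hy]
  rw [h1.fderiv_eq, β.fderiv]

theorem proposition1p3
    {E : Type*} [NormedAddCommGroup E] [NormedSpace ℝ E] [FiniteDimensional ℝ E]
    {M : Type*} [TopologicalSpace M] [T2Space M] [SecondCountableTopology M]
    [ChartedSpace E M] [IsManifold 𝓘(ℝ, E) ∞ M]
    (Ω : SymplecticForm E M)
    {F : Type*} [NormedAddCommGroup F] [NormedSpace ℝ F] [FiniteDimensional ℝ F]
    {X : Type*} [TopologicalSpace X] [ChartedSpace F X] [IsManifold 𝓘(ℝ, F) ∞ X]
    (f : X → M) (hf : IsSmoothEmbedding 𝓘(ℝ, F) 𝓘(ℝ, E) ∞ f)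
    (hclosed : IsClosed (Set.range f)) (hnc : ¬ IsCoisotropic F Ω f) :
    ¬ IsCHRigid Ω (Set.range f) := by
  unfold IsCoisotropic at hnc
  push Not at hnc
  obtain ⟨p, v, hv, hvn⟩ := hnc
  have : Nonempty M := ⟨f p⟩
  have hi := hf.isImmersion.isImmersionAt p
  have hψ := hi.codChart_mem_maximalAtlas
  set ψ := hi.codChart
  have hps : f p ∈ ψ.source := hi.mem_codChart_source
  set y₀ := ψ (f p)
  have hy₀ : y₀ ∈ ψ.target := ψ.map_source hps
  have hy₀p : ψ.symm y₀ = f p := ψ.left_inv hps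
  -- The embedding topology excludes other sheets of `N`: inside `W`, only the piece of `N`
  -- parametrised by `domChart` is present.
  obtain ⟨W, hW, hWφ⟩ := hf.isEmbedding.isInducing.isOpen_iff.1 hi.domChart.open_source
  have hpW : f p ∈ W := by
    have : p ∈ f ⁻¹' W := hWφ ▸ hi.mem_domChart_source
    exact this
  let U : Set E := ψ.target ∩ ψ.symm ⁻¹' W
  have hUo : U ∈ nhds y₀ :=
    (ψ.symm.isOpen_inter_preimage hW).mem_nhds ⟨hy₀, by simpa [hy₀p] using hpW⟩
  let D : E →L[ℝ] E := mfderiv 𝓘(ℝ, E) 𝓘(ℝ, E) ψ.symm y₀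
  -- points of `N` near `f p` lie in a linear subspace of the chart
  have hNlin : ∀ y ∈ U, ψ.symm y ∈ range f → ∃ w : F, y = hi.equiv (w, 0) := by
    rintro y ⟨hyt, hyW⟩ ⟨q, hq⟩
    have hqs : q ∈ hi.domChart.source := by
      rw [← hWφ]
      simpa [hq] using hyW
    refine ⟨hi.domChart q, ?_⟩
    rw [← hi.codChart_apply hqs, hq]
    exact (ψ.right_inv hyt).symm
  let B : E →L[ℝ] E →L[ℝ] ℝ := Ω.form (f p)
  have hB : ∀ a b : E, Ω.inChart ψ y₀ a b = B (D a) (D b) := by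
    have h : ∀ x : M, x = f p → ∀ a b : E, Ω.form x a b = B a b := by
      rintro _ rfl a b
      rfl
    exact fun a b ↦ h _ hy₀p _ _
  let β : E →L[ℝ] ℝ := (B.flip v).comp D
  have hβ : ∀ w : F, β (hi.equiv (w, 0)) = 0 := by
    intro w
    obtain ⟨u, hu⟩ := hi.mfderiv_codChart_symm_equiv w
    have h1 : β (hi.equiv (w, 0)) = Ω.form (f p) (mfderiv 𝓘(ℝ, F) 𝓘(ℝ, E) f p u) v :=
      congrArg (fun z : E ↦ B z v) hu.symm
    rw [h1, Ω.form_neg_swap, hv, neg_zero]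
  obtain ⟨h, hh, hc, hsupp, hzero, hfd⟩ := exists_contDiff_hasCompactSupport_fderiv_eq hUo β
  have hU : tsupport h ⊆ ψ.target := hsupp.trans inter_subset_left
  have hN : ∀ x ∈ range f, extendByZero ψ h x = 0 := by
    intro x hx
    by_contra hne
    obtain ⟨y, hy, rfl⟩ : x ∈ ψ.symm '' tsupport h := by
      by_contra hn
      exact hne (extendByZero_of_notMem_image hn)
    obtain ⟨w, rfl⟩ := hNlin y (hsupp hy) hx
    exact hne ((extendByZero_symm (hU hy)).trans (hzero _ (hβ w)))
  obtain ⟨Φ, hΦ, hcurve⟩ := Ω.exists_flow_extendByZero hψ hh hc hU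
  obtain ⟨α, hα0, hα, hαΦ⟩ := hcurve y₀ hy₀
  -- By nondegeneracy, `dh = Ω(·, v)` at `f p` forces the Hamiltonian field there to be `v`.
  have hDV : D (Ω.chartField ψ h y₀) = v := by
    refine Ω.eq_of_forall_form_eq (f p) fun u ↦ ?_
    obtain ⟨a, ha⟩ : ∃ a : E, D a = u :=
      (ψ.mdifferentiable_of_mem_maximalAtlas hψ).symm.mfderiv_surjective hy₀ u
    have h1 := Ω.inChart_chartField (h := h) hψ hy₀ a
    rw [hB, hfd] at h1
    exact ha ▸ h1
  intro hrigid
  have hfix : ∀ s ∈ Icc (0 : ℝ) 1, (fun x ↦ Φ x s) '' range f = range f := by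
    intro s hs
    obtain ⟨hmem, hδ⟩ := chekanovHofer_flow_eq_zero Ω hψ hh hc hU hΦ hN hs
    exact (hrigid _ ⟨id, id_mem_Ham Ω, (image_id _).symm⟩ _ hmem hδ).symm
  have hαN : ∀ s ∈ Icc (0 : ℝ) 1, ψ.symm (α s) ∈ range f := by
    intro s hs
    rw [← (hαΦ s ⟨by linarith [hs.1], by linarith [hs.2]⟩).2, hy₀p, ← hfix s hs]
    exact ⟨f p, mem_range_self p, rfl⟩
  have hev : ∀ᶠ s in nhdsWithin 0 (Icc (0 : ℝ) 1), ∃ w : F, α s = hi.equiv (w, 0) := by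
    have hαU : ∀ᶠ s in nhds 0, α s ∈ U := hα.continuousAt (by rwa [hα0])
    filter_upwards [nhdsWithin_le_nhds hαU, self_mem_nhdsWithin] with s hsU hs
    exact hNlin _ hsU (hαN s hs)
  -- The normal coordinate of the orbit vanishes for small `s ≥ 0`. One-sided derivatives at `0` are
  -- unique on `[0,1]`, so the normal component of the initial velocity is zero.
  let π : E →L[ℝ] hi.complement :=
    (ContinuousLinearMap.snd ℝ F hi.complement).comp hi.equiv.symm.toContinuousLinearMap
  have h0 : (0 : ℝ) ∈ Icc (0 : ℝ) 1 := by norm_num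
  have hd : HasDerivWithinAt (π ∘ α) (π (Ω.chartField ψ h y₀)) (Icc 0 1) 0 :=
    (π.hasFDerivAt.comp_hasDerivAt 0 hα).hasDerivWithinAt
  have hπ : π ∘ α =ᶠ[nhdsWithin 0 (Icc (0 : ℝ) 1)] fun _ ↦ 0 := by
    filter_upwards [hev] with s hs
    obtain ⟨w, hw⟩ := hs
    simp [π, hw]
  have hd0 : HasDerivWithinAt (π ∘ α) 0 (Icc 0 1) 0 :=
    (hasDerivWithinAt_const 0 _ 0).congr_of_eventuallyEq_of_mem hπ h0
  have hπV : π (Ω.chartField ψ h y₀) = 0 :=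
    ((uniqueDiffOn_Icc one_pos) 0 h0).eq_deriv _ hd hd0
  have hV : Ω.chartField ψ h y₀ = hi.equiv ((hi.equiv.symm (Ω.chartField ψ h y₀)).1, 0) := by
    rw [← hπV]
    exact (hi.equiv.apply_symm_apply _).symm
  obtain ⟨u, hu⟩ := hi.mfderiv_codChart_symm_equiv
    (hi.equiv.symm (Ω.chartField ψ h y₀)).1
  rw [← hV] at hu
  exact hvn u (hu.trans hDV)
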